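/- Let $\{a,b\}$ be an ordered binary alphabet (with $a<b$ or $b<a$). Let $\mu$ be the morphism given by $\mu(a)=auab^k$ and $\mu(b)=b^\ell$, where $u\in\{a,b\}^*$, $k\ge 0$ and $\ell\ge 1$. Assume that $\mu$ is not primitive (there is no $t\ge 1$ such that each letter occurs in $\mu^t(a)$ and in $\mu^t(b)$) and that the infinite word $x=\mu^\infty(a)$, the limit of the words $\mu^i(a)$, is aperiodic, that is, not ultimately periodic. For a finite word $w$, let $\mathrm{bwt}(w)$ be the concatenation of the last letters of the lexicographically sorted list of the $|w|$ cyclic rotations of $w$, and let $r_{\mathrm{bwt}}(w)$ be the number of maximal equal-letter runs of $\mathrm{bwt}(w)$. Let $R_i$ be the set of integers $q\ge 0$ such that $ab^qa$ is a circular factor of $\mu^i(a)$, that is, a factor of some cyclic rotation of $\mu^i(a)$. Then, as $i\to\infty$, with constants that may depend on $\mu$: 1. $r_{\mathrm{bwt}}(\mu^i(a))=\Omega(|R_i|)$. 2. Suppose that $\mu$ is growing (that is, $|\mu^i(c)|\to\infty$ for both letters $c$), or that $\mu$ is not growing and the number $f_x(n)$ of distinct factors of $x$ of length $n$ satisfies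 $f_x(n)=\Theta(n^2)$. Then $r_{\mathrm{bwt}}(\mu^i(a))=\Omega(i)$, and moreover $r_{\mathrm{bwt}}(\mu^i(a))=\Theta(\log n)$ where $n=|\mu^i(a)|$. -/

import Mathlib

open Filter Asymptotics

namespace MorphicBWT

/-- A morphism of the free monoid `A*` is given by the images `μ : A → List A` of the letters;
this is the map `A* → A*` that extends it multiplicatively. -/
def extend {A : Type*} (μ : A → List A) (w : List A) : List A := w.flatMap μ

/-- The iterate `μ^i(w)`. -/
def iter {A : Type*} (μ : A → List A) (i : ℕ) (w : List A) : List A := (extend μ)^[i] w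

/-- `μ` is primitive: for some `t > 0`, every letter `c` occurs in `μ^t(d)` for every letter `d`. -/
def IsPrimitive {A : Type*} (μ : A → List A) : Prop :=
  ∃ t : ℕ, 0 < t ∧ ∀ c d : A, c ∈ iter μ t [d]

/-- `μ` is growing: `|μ^i(c)| → ∞` for every letter `c`. -/
def IsGrowing {A : Type*} (μ : A → List A) : Prop :=
  ∀ c : A, Tendsto (fun i : ℕ => (iter μ i [c]).length) atTop atTop

/-- `μ` is prolongable on `a`: `μ(a) = av` for a nonempty word `v`. -/
def IsProlongable {A : Type*} (μ : A → List A) (a : A) : Prop :=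
  ∃ v : List A, v ≠ [] ∧ μ a = a :: v

/-- The infinite word `μ^∞(a)` generated by a non-erasing morphism `μ` prolongable on `a`. Its
letter in position `n` (from `0`) is the letter of `μ^n(a)` in that position; the default value
of `getD` is never used, and all the words `μ^i(a)` are prefixes of it, see
`length_iter_gt` and `getElem_iter_eq_fixedPoint`. -/
def fixedPoint {A : Type*} (μ : A → List A) (a : A) (n : ℕ) : A := (iter μ n [a]).getD n a

/-- The infinite word `x` is ultimately periodic. -/
def IsUltimatelyPeriodic {A : Type*} (x : ℕ → A) : Prop :=
  ∃ p : ℕ, 0 < p ∧ ∃ K : ℕ, ∀ n : ℕ, K ≤ n → x (n + p) = x n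

/-- The infinite word `x` is aperiodic. -/
def IsAperiodic {A : Type*} (x : ℕ → A) : Prop := ¬ IsUltimatelyPeriodic x

/-- The set of factors of length `n` of the infinite word `x`. -/
def factors {A : Type*} (x : ℕ → A) (n : ℕ) : Set (List A) :=
  {v | ∃ p : ℕ, v = (List.range n).map (fun j => x (p + j))}

/-- The factor complexity `f_x(n)`. -/
noncomputable def factorComplexity {A : Type*} (x : ℕ → A) (n : ℕ) : ℕ := (factors x n).ncard

/-- `v` is a circular factor of `w`: a factor of a conjugate of `w`. -/
def IsCircularFactor {A : Type*} (v w : List A) : Prop :=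
  ∃ z : List A, z ~r w ∧ v <:+: z

/-- The set of all `q` such that `a b^q a` is a circular factor of `w`. -/
def runSet {A : Type*} (a b : A) (w : List A) : Set ℕ :=
  {q | IsCircularFactor ([a] ++ List.replicate q b ++ [a]) w}

/-- The list of the `|w|` cyclic rotations of `w`, with multiplicity. -/
def rotations {A : Type*} (w : List A) : List (List A) :=
  (List.range w.length).map (fun j => w.rotate j)

/-- The Burrows-Wheeler transform: the last letters of the lexicographically sorted rotations. -/
def bwt {A : Type*} [LinearOrder A] (w : List A) : List A :=
  ((rotations w).insertionSort (fun y z => y ≤ z)).filterMap List.getLast?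

/-- The number of maximal equal-letter runs of `w`; `destutter` keeps one letter of each run. -/
def runs {A : Type*} [DecidableEq A] (w : List A) : ℕ := (w.destutter (fun c d => c ≠ d)).length

/-- The number `r_bwt(w)` of equal-letter runs of the Burrows-Wheeler transform of `w`. -/
def rBwt {A : Type*} [LinearOrder A] (w : List A) : ℕ := runs (bwt w)

theorem iter_succ {A : Type*} (μ : A → List A) (i : ℕ) (w : List A) :
    iter μ (i + 1) w = extend μ (iter μ i w) := by
  simp [iter, Function.iterate_succ_apply']

theorem length_le_length_extend {A : Type*} {μ : A → List A} (hne : ∀ c, μ c ≠ []) (w : List A) :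
    w.length ≤ (extend μ w).length := by
  induction w with
  | nil => simp [extend]
  | cons c w ih =>
    have h1 := List.length_pos_iff.mpr (hne c)
    simp only [extend, List.flatMap_cons, List.length_append, List.length_cons] at ih ⊢
    omega

theorem iter_eq_cons {A : Type*} {μ : A → List A} {a : A} (h : IsProlongable μ a) (i : ℕ) :
    ∃ v, iter μ i [a] = a :: v := by
  obtain ⟨s, -, hs⟩ := h
  induction i with
  | zero => exact ⟨[], rfl⟩
  | succ i ih =>
    obtain ⟨v, hv⟩ := ih
    exact ⟨s ++ v.flatMap μ, by simp [iter_succ, hv, extend, hs]⟩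

theorem length_iter_gt {A : Type*} {μ : A → List A} {a : A} (hne : ∀ c, μ c ≠ [])
    (h : IsProlongable μ a) (i : ℕ) : i < (iter μ i [a]).length := by
  induction i with
  | zero => simp [iter]
  | succ i ih =>
    obtain ⟨v, hv⟩ := iter_eq_cons h i
    obtain ⟨s, hs0, hs⟩ := h
    have h1 := List.length_pos_iff.mpr hs0
    have h2 := length_le_length_extend hne v
    rw [iter_succ, hv]
    rw [hv] at ih
    simp only [extend, List.flatMap_cons, List.length_append, List.length_cons, hs] at ih h2 ⊢
    omega

theorem iter_prefix_succ {A : Type*} {μ : A → List A} {a : A} (h : IsProlongable μ a) (i : ℕ) :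
    iter μ i [a] <+: iter μ (i + 1) [a] := by
  induction i with
  | zero =>
    obtain ⟨s, -, hs⟩ := h
    exact ⟨s, by simp [iter, extend, hs]⟩
  | succ i ih =>
    obtain ⟨t, ht⟩ := ih
    refine ⟨extend μ t, ?_⟩
    have h1 : ∀ y z : List A, extend μ (y ++ z) = extend μ y ++ extend μ z := by
      intro y z; simp [extend]
    calc iter μ (i + 1) [a] ++ extend μ t = extend μ (iter μ i [a] ++ t) := by
          rw [h1, iter_succ]
      _ = iter μ (i + 1 + 1) [a] := by rw [ht, ← iter_succ]

theorem iter_prefix {A : Type*} {μ : A → List A} {a : A} (h : IsProlongable μ a) {i j : ℕ}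
    (hij : i ≤ j) : iter μ i [a] <+: iter μ j [a] := by
  induction j, hij using Nat.le_induction with
  | base => exact List.prefix_rfl
  | succ j _ ih => exact ih.trans (iter_prefix_succ h j)

theorem getElem_iter_eq_fixedPoint {A : Type*} {μ : A → List A} {a : A} (hne : ∀ c, μ c ≠ [])
    (h : IsProlongable μ a) (i n : ℕ) (hn : n < (iter μ i [a]).length) :
    (iter μ i [a])[n] = fixedPoint μ a n := by
  have hl := length_iter_gt hne h n
  rw [fixedPoint, List.getD_eq_getElem _ _ hl]
  rcases le_total i n with hin | hin
  · exact (iter_prefix h hin).getElem hn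
  · exact ((iter_prefix h hin).getElem hl).symm

/-- The sets counted by `factorComplexity` are finite over a finite alphabet. -/
theorem factors_finite {A : Type*} [Finite A] (x : ℕ → A) (n : ℕ) : (factors x n).Finite := by
  refine (List.finite_length_eq A n).subset ?_
  rintro v ⟨p, rfl⟩
  simp

theorem runSet_finite {A : Type*} (a b : A) (w : List A) : (runSet a b w).Finite := by
  refine (Set.finite_Iio w.length).subset ?_
  rintro q ⟨z, hz, hq⟩
  have h1 := hq.length_le
  have h2 := hz.perm.length_eq
  simp at h1 ⊢
  omega

end MorphicBWT

namespace MorphicBWT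

/-! Factor `μ(a)` as `a b^(p₁) ⋯ a b^(pₛ) a b^k` with `s ≥ 1`, and put `m = s + 1`. Then `μ^i(a)`
is, up to rotation, a circular sequence of blocks `b^q a`, and `μ` sends an exponent `q` to `p₁, …,
pₛ, k + ℓq`. The order of the alphabet enters only through the fact that rotations with a common
prefix are consecutive in the sorted list.

Lower bound (`ncard_circularRuns_le_rBwt`): for each exponent `q` below the largest, `M`, some
rotation starting with `b^q a` is preceded by `a` and another, cut out of the run `b^M`, by `b`. So
the transform changes letter inside the interval of that prefix, and these intervals are disjoint.
If some `pⱼ` increases under `q ↦ k + ℓq`, its orbit gives `i` distinct exponents.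

Upper bound (`rBwt_le_of_blockRotation`): a change between rotations starting with different powers
of `b` is charged to an exponent, of which there are `O(i)`. Otherwise both rotations start with the
same power, inside runs of different lengths, and the change is charged to their longest common
prefix, encoded by block exponents. Passing from `i` to `i + 1`, such codes are lifted by `μ`
(`exists_liftCode`), apart from a finite set independent of `i`, by recognizability
(`lt_of_agree_of_mod_ne`). Hence there are `O(i)` codes.

The growth hypotheses rule out `k = 0`, `ℓ = 1`, where factor complexity is linear along powers of
`m`; aperiodicity then rules out the remaining degenerate case `μ(a) = a^m`. Finally `log |μ^i(a)| =
Θ(i)`. -/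

/-! ### Letter changes in the transform, and intervals of sorted rotations -/

theorem runs_cons_eq_card {A : Type*} [DecidableEq A] (c : A) (l : List A) :
    runs (c :: l) =
      ((Finset.range l.length).filter (fun t => (c :: l)[t]? ≠ l[t]?)).card + 1 := by
  induction l generalizing c with
  | nil => simp [runs]
  | cons d l ih =>
    have h := ih d
    have key : runs (c :: d :: l) = runs (d :: l) + if c ≠ d then 1 else 0 := by
      unfold runs
      by_cases hcd : c = d
      · subst hcd; simp [List.destutter]
      · simp [List.destutter, hcd]
    rw [key, h, List.length_cons, Finset.card_filter, Finset.card_filter, Finset.sum_range_succ']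
    simp
    ring

theorem getElem?_filterMap_of_isSome {α β : Type*} (f : α → Option β) (l : List α)
    (h : ∀ x ∈ l, (f x).isSome) (t : ℕ) : (l.filterMap f)[t]? = l[t]?.bind f := by
  induction l generalizing t with
  | nil => simp
  | cons x l ih =>
    obtain ⟨y, hy⟩ := Option.isSome_iff_exists.1 (h x (by simp))
    have ih' := ih (fun z hz => h z (by simp [hz]))
    rw [List.filterMap_cons_some hy]
    cases t with
    | zero => simp [hy]
    | succ t => simpa using ih' t

/-- The `t`-th element of the sorted list of the rotations of `w`. -/
def sortedRotation {A : Type*} [LinearOrder A] (w : List A) (t : ℕ) : List A :=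
  ((rotations w).insertionSort (fun y z => y ≤ z)).getD t []

/-- The positions at which the Burrows-Wheeler transform of `w` changes its letter. -/
def bwtChanges {A : Type*} [LinearOrder A] (w : List A) : Finset ℕ :=
  (Finset.range (w.length - 1)).filter
    (fun t => (sortedRotation w t).getLast? ≠ (sortedRotation w (t + 1)).getLast?)

section
variable {A : Type*} [LinearOrder A]

theorem length_sortedRotations (w : List A) :
    ((rotations w).insertionSort (fun y z => y ≤ z)).length = w.length := by
  rw [List.length_insertionSort]; simp [rotations]

theorem mem_sortedRotations_iff {w z : List A} (hw : w ≠ []) :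
    z ∈ (rotations w).insertionSort (fun y z => y ≤ z) ↔ w ~r z := by
  have h0 : 0 < w.length := List.length_pos_iff.2 hw
  rw [List.mem_insertionSort]
  simp only [rotations, List.mem_map, List.mem_range]
  constructor
  · rintro ⟨j, -, rfl⟩; exact ⟨j, rfl⟩
  · rintro ⟨j, rfl⟩
    exact ⟨j % w.length, Nat.mod_lt _ h0, by rw [List.rotate_mod]⟩

theorem sortedRotation_isRotated {w : List A} {t : ℕ} (ht : t < w.length) :
    w ~r sortedRotation w t := by
  have hw : w ≠ [] := by rintro rfl; simp at ht
  rw [← mem_sortedRotations_iff hw, sortedRotation,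
    List.getD_eq_getElem _ _ (by rwa [length_sortedRotations])]
  exact List.getElem_mem _

theorem exists_sortedRotation_eq {w z : List A} (hw : w ≠ []) (hz : w ~r z) :
    ∃ t < w.length, sortedRotation w t = z := by
  rw [← mem_sortedRotations_iff hw] at hz
  obtain ⟨t, ht, rfl⟩ := List.getElem_of_mem hz
  refine ⟨t, by rwa [length_sortedRotations] at ht, ?_⟩
  rw [sortedRotation, List.getD_eq_getElem _ _ ht]

theorem rBwt_eq_card_add_one {w : List A} (hw : w ≠ []) :
    rBwt w = (bwtChanges w).card + 1 := by
  have hs : ∀ z ∈ (rotations w).insertionSort (fun y z => y ≤ z), (z.getLast?).isSome := by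
    intro z hz
    have := ((mem_sortedRotations_iff hw).1 hz).perm.length_eq
    rw [List.getLast?_isSome]
    rintro rfl
    exact hw (by simpa using this)
  have hget := getElem?_filterMap_of_isSome _ _ hs
  have hlen : (bwt w).length = w.length := by
    rw [bwt, ← length_sortedRotations w, List.filterMap_length_eq_length]
    exact hs
  have hget' : ∀ t < w.length, (bwt w)[t]? = (sortedRotation w t).getLast? := by
    intro t ht
    rw [← length_sortedRotations w] at ht
    rw [bwt, hget, sortedRotation, List.getD_eq_getElem _ _ ht, List.getElem?_eq_getElem ht]
    rfl
  rw [rBwt]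
  cases hb : bwt w with
  | nil => rw [hb] at hlen; exact absurd (List.length_eq_zero_iff.1 hlen.symm) hw
  | cons c l =>
    rw [runs_cons_eq_card]
    rw [hb] at hlen hget'
    simp only [List.length_cons] at hlen
    have e : w.length - 1 = l.length := by omega
    rw [bwtChanges, e]
    congr 2
    refine Finset.filter_congr fun t ht => ?_
    rw [Finset.mem_range] at ht
    rw [← hget' t (by omega), ← hget' (t + 1) (by omega)]
    simp

theorem prefix_of_le_of_le {v x y z : List A} (hx : v <+: x) (hz : v <+: z) (hxy : x ≤ y)
    (hyz : y ≤ z) : v <+: y := by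
  induction v generalizing x y z with
  | nil => simp
  | cons c v ih =>
    obtain ⟨x, rfl⟩ := hx
    obtain ⟨z, rfl⟩ := hz
    cases y with
    | nil => exact absurd (List.nil_lt_cons _ _) (not_lt.2 hxy)
    | cons d y =>
      have h1 := not_lt.2 hxy
      have h2 := not_lt.2 hyz
      rw [List.cons_append, List.cons_lt_cons_iff, not_or, not_and] at h1 h2
      obtain rfl : c = d := le_antisymm (not_lt.1 h1.1) (not_lt.1 h2.1)
      rw [List.cons_prefix_cons]
      exact ⟨rfl, ih (List.prefix_append _ _) (List.prefix_append _ _) (not_lt.1 (h1.2 rfl))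
        (not_lt.1 (h2.2 rfl))⟩

theorem sortedRotation_mono {w : List A} {s t : ℕ} (hst : s ≤ t) (ht : t < w.length) :
    sortedRotation w s ≤ sortedRotation w t := by
  have h := List.pairwise_insertionSort (fun y z : List A => y ≤ z) (rotations w)
  rw [← length_sortedRotations w] at ht
  rcases hst.eq_or_lt with rfl | hlt
  · exact le_rfl
  · rw [sortedRotation, sortedRotation, List.getD_eq_getElem _ _ ht,
      List.getD_eq_getElem _ _ (hlt.trans ht)]
    exact List.pairwise_iff_getElem.1 h _ _ _ _ hlt

/-- The rotations with a given prefix are consecutive in the sorted list of rotations. -/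
theorem prefix_sortedRotation {w v : List A} {r s t : ℕ} (hrs : r ≤ s) (hst : s ≤ t)
    (ht : t < w.length) (hr : v <+: sortedRotation w r) (hv : v <+: sortedRotation w t) :
    v <+: sortedRotation w s :=
  prefix_of_le_of_le hr hv (sortedRotation_mono hrs (hst.trans_lt ht)) (sortedRotation_mono hst ht)

end

theorem exists_ne_succ {α : Type*} {h : ℕ → α} {s t : ℕ} (hst : s ≤ t) (hne : h s ≠ h t) :
    ∃ r, s ≤ r ∧ r < t ∧ h r ≠ h (r + 1) := by
  by_contra! H
  apply hne
  induction t, hst using Nat.le_induction with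
  | base => rfl
  | succ t hst ih =>
    rw [← H t hst (by omega)]
    by_contra hne'
    exact hne' (ih hne' (fun r h1 h2 => H r h1 (by omega)))

/-! ### Lower bound by the number of circular runs -/

/-- The word `b^q a`. -/
def block {A : Type*} (a b : A) (q : ℕ) : List A := List.replicate q b ++ [a]

theorem block_prefix_unique {A : Type*} {a b : A} (hab : a ≠ b) {q r : ℕ} {z : List A}
    (hq : block a b q <+: z) (hr : block a b r <+: z) : q = r := by
  induction q generalizing r z with
  | zero =>
    cases r with
    | zero => rfl
    | succ r =>
      obtain ⟨y, rfl⟩ := hq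
      simp [block, List.replicate_succ, hab.symm] at hr
  | succ q ih =>
    obtain ⟨y, rfl⟩ := hq
    cases r with
    | zero => simp [block, List.replicate_succ, hab] at hr
    | succ r =>
      simp only [block, List.replicate_succ, List.cons_append, List.cons_prefix_cons] at hr
      rw [ih (List.prefix_append (block a b q) y) (by simpa [block] using hr.2)]

/-- The lengths of the runs of `b` between two circularly consecutive letters `a` of `w`: all `q`
such that some rotation of `w` starts with `b^q a` and ends with `a`. -/
def circularRuns {A : Type*} (a b : A) (w : List A) : Set ℕ :=
  {q | ∃ z, w ~r z ∧ block a b q <+: z ∧ z.getLast? = some a}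

theorem circularRuns_finite {A : Type*} (a b : A) (w : List A) : (circularRuns a b w).Finite := by
  refine (Set.finite_Iio w.length).subset ?_
  rintro q ⟨z, hz, hq, -⟩
  have h1 := hq.length_le
  have h2 := hz.perm.length_eq
  simp [block] at h1 ⊢
  omega

/-- The inclusion can be strict: in `circularRuns` the two letters `a` that delimit a run may be the
same letter of the circular word, as for `w = a`. -/
theorem runSet_subset_circularRuns {A : Type*} (a b : A) (w : List A) :
    runSet a b w ⊆ circularRuns a b w := by
  rintro q ⟨z, hz, x, y, hxy⟩
  refine ⟨block a b q ++ (y ++ (x ++ [a])), hz.symm.trans ⟨(x ++ [a]).length, ?_⟩, by simp,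
    by simp [← List.append_assoc]⟩
  rw [← hxy]
  have : x ++ ([a] ++ List.replicate q b ++ [a]) ++ y = (x ++ [a]) ++ (block a b q ++ y) := by
    simp [block]
  rw [this, List.rotate_append_length_eq]
  simp

theorem ncard_circularRuns_le_rBwt {A : Type*} [LinearOrder A] {a b : A} (hab : a ≠ b)
    {w : List A} (hw : w ≠ []) : (circularRuns a b w).ncard ≤ rBwt w := by
  classical
  have hfin := circularRuns_finite a b w
  rcases (circularRuns a b w).eq_empty_or_nonempty with he | hne
  · simp [he]
  obtain ⟨M, hM, hmax⟩ := hfin.exists_maximal hne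
  rw [rBwt_eq_card_add_one hw]
  have key : ∀ q ∈ circularRuns a b w \ {M}, ∃ t ∈ bwtChanges w,
      block a b q <+: sortedRotation w t := by
    rintro q ⟨⟨z, hz, hpz, hlz⟩, hqM⟩
    have hqlt : q < M := by
      rcases lt_or_ge q M with h | h
      · exact h
      · exact absurd (le_antisymm (hmax ⟨z, hz, hpz, hlz⟩ h) h) (by simpa using hqM)
    obtain ⟨y, hy, ⟨x, rfl⟩, -⟩ := hM
    -- Moving `M - q > 0` letters `b` of the longest run to the end gives a rotation that starts
    -- with `b^q a` and ends with `b`.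
    have e : block a b M = List.replicate (M - q) b ++ block a b q := by
      rw [block, block, ← List.append_assoc, List.replicate_append_replicate]
      congr 3; omega
    have hy' : w ~r block a b q ++ (x ++ List.replicate (M - q) b) := by
      refine hy.trans ⟨(List.replicate (M - q) b).length, ?_⟩
      rw [e, List.append_assoc, List.rotate_append_length_eq]
      simp
    obtain ⟨s, hs, rfl⟩ := exists_sortedRotation_eq hw hz
    obtain ⟨t, ht, hty⟩ := exists_sortedRotation_eq hw hy'
    have hpt : block a b q <+: sortedRotation w t := by rw [hty]; simp
    have hlt : (sortedRotation w t).getLast? = some b := by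
      rw [hty, ← List.append_assoc, List.getLast?_append, List.getLast?_replicate,
        if_neg (by omega)]
      rfl
    have hne' : (sortedRotation w s).getLast? ≠ (sortedRotation w t).getLast? := by
      rw [hlz, hlt]; simpa using hab
    rcases le_total s t with hst | hst
    · obtain ⟨r, h1, h2, h3⟩ := exists_ne_succ (h := fun t => (sortedRotation w t).getLast?) hst hne'
      exact ⟨r, by simp only [bwtChanges, Finset.mem_filter, Finset.mem_range]; exact ⟨by omega, h3⟩,
        prefix_sortedRotation h1 h2.le ht hpz hpt⟩
    · obtain ⟨r, h1, h2, h3⟩ :=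
        exists_ne_succ (h := fun t => (sortedRotation w t).getLast?) hst hne'.symm
      exact ⟨r, by simp only [bwtChanges, Finset.mem_filter, Finset.mem_range]; exact ⟨by omega, h3⟩,
        prefix_sortedRotation h1 h2.le hs hpt hpz⟩
  choose! g hg hgp using key
  have h1 : (circularRuns a b w \ {M}).ncard ≤ (bwtChanges w : Set ℕ).ncard := by
    refine Set.ncard_le_ncard_of_injOn g hg ?_ (Finset.finite_toSet _)
    intro q hq r hr hqr
    exact block_prefix_unique hab (hgp q hq) (by rw [hqr]; exact hgp r hr)
  rw [Set.ncard_coe_finset] at h1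
  -- The value `M`, which has no change assigned to it, is paid for by the `+ 1` between changes and
  -- runs.
  have h2 := Set.ncard_sdiff_singleton_add_one hM hfin
  omega

/-! ### Rotations of a circular word of blocks -/

section
variable {A : Type*}

/-- For a sequence `Q` of period `N + 1`, the rotation of the circular word
`b^(Q 0) a b^(Q 1) a ⋯ b^(Q N) a` that starts with the last `p` letters `b` of its block `n`. -/
def blockRotation (a b : A) (Q : ℕ → ℕ) (N n p : ℕ) : List A :=
  block a b p ++
    (((List.range' (n + 1) N).map Q).flatMap (block a b) ++ List.replicate (Q n - p) b)

theorem rotate_blockRotation_succ (a b : A) (Q : ℕ → ℕ) (N n p : ℕ) (hp : p < Q n) :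
    (blockRotation a b Q N n (p + 1)).rotate 1 = blockRotation a b Q N n p := by
  have e : Q n - p = (Q n - (p + 1)) + 1 := by omega
  rw [blockRotation, blockRotation, e, List.replicate_succ' (n := Q n - (p + 1))]
  simp [block, List.replicate_succ]

theorem rotate_blockRotation_zero (a b : A) {Q : ℕ → ℕ} {N : ℕ} (hQ : ∀ n, Q (n + (N + 1)) = Q n)
    (n : ℕ) : (blockRotation a b Q N n 0).rotate 1 = blockRotation a b Q N (n + 1) (Q (n + 1)) := by
  have e1 : blockRotation a b Q N n 0 =
      a :: (((List.range' (n + 1) N).map Q).flatMap (block a b) ++ List.replicate (Q n) b) := by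
    simp [blockRotation, block]
  rw [e1, List.rotate_cons_succ, List.rotate_zero]
  have e2 : ((List.range' (n + 1) (N + 1)).map Q).flatMap (block a b) =
      (((List.range' (n + 1) N).map Q).flatMap (block a b) ++ List.replicate (Q n) b) ++ [a] := by
    rw [List.range'_1_concat, ← hQ n, show n + 1 + N = n + (N + 1) by ring]
    simp [block]
  rw [← e2, List.range'_succ]
  simp [blockRotation]

theorem exists_rotate_eq_blockRotation (a b : A) {Q : ℕ → ℕ} {N : ℕ}
    (hQ : ∀ n, Q (n + (N + 1)) = Q n) (j : ℕ) :
    ∃ n p, p ≤ Q n ∧ (blockRotation a b Q N 0 (Q 0)).rotate j = blockRotation a b Q N n p := by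
  induction j with
  | zero => exact ⟨0, Q 0, le_rfl, by simp⟩
  | succ j ih =>
    obtain ⟨n, p, hp, h⟩ := ih
    rw [← List.rotate_rotate, h]
    cases p with
    | zero => exact ⟨n + 1, Q (n + 1), le_rfl, rotate_blockRotation_zero a b hQ n⟩
    | succ p => exact ⟨n, p, by omega, rotate_blockRotation_succ a b Q N n p (by omega)⟩

theorem isRotated_blockRotation (a b : A) {Q : ℕ → ℕ} {N : ℕ}
    (hQ : ∀ n, Q (n + (N + 1)) = Q n) (n : ℕ) :
    blockRotation a b Q N 0 (Q 0) ~r blockRotation a b Q N n (Q n) := by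
  induction n with
  | zero => exact List.IsRotated.refl _
  | succ n ih =>
    have h : ∀ p, p ≤ Q n → blockRotation a b Q N n (Q n) ~r blockRotation a b Q N n p := by
      intro p hp
      induction hd : Q n - p generalizing p with
      | zero => rw [show p = Q n by omega]
      | succ d ihd =>
        exact (ihd (p + 1) (by omega) (by omega)).trans
          ⟨1, rotate_blockRotation_succ a b Q N n p (by omega)⟩
    exact (ih.trans (h 0 (Nat.zero_le _))).trans ⟨1, rotate_blockRotation_zero a b hQ n⟩

/-- If only part of the run is in front, its remainder is at the end; if all of it is, the word ends
with the `a` of the circularly preceding block. So the transform tests whether the leading run is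
complete. -/
theorem getLast?_blockRotation (a b : A) (Q : ℕ → ℕ) (N n p : ℕ) (hp : p ≤ Q n) :
    (blockRotation a b Q N n p).getLast? = some (if p = Q n then a else b) := by
  rw [blockRotation, ← List.append_assoc, List.getLast?_append]
  split_ifs with h
  · subst h
    rcases N with _ | N
    · simp [block]
    · rw [List.range'_1_concat, Nat.sub_self, List.replicate_zero, List.getLast?_nil, Option.none_or,
        List.map_append, List.flatMap_append, ← List.append_assoc, List.getLast?_append]
      simp [block]
  · rw [List.getLast?_replicate, if_neg (by omega)]
    rfl

theorem mem_circularRuns_blockRotation (a b : A) {Q : ℕ → ℕ} {N : ℕ}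
    (hQ : ∀ n, Q (n + (N + 1)) = Q n) {w : List A} (hw : w ~r blockRotation a b Q N 0 (Q 0))
    (n : ℕ) : Q n ∈ circularRuns a b w :=
  ⟨_, hw.trans (isRotated_blockRotation a b hQ n), List.prefix_append _ _,
    by rw [getLast?_blockRotation _ _ _ _ _ _ le_rfl, if_pos rfl]⟩

end

/-! ### Upper bound by exponents and maximal agreements -/

/-- The sequence of blocks on which the positions `n₁` and `n₂` of the block sequence `Q` agree,
when the two agree on exactly `t` blocks, with the common part of the two delimiting blocks. -/
def agreementCode (Q : ℕ → ℕ) (n₁ n₂ t : ℕ) : List ℕ :=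
  (List.range (t + 2)).map (fun j => min (Q (n₁ + j)) (Q (n₂ + j)))

/-- `Q` has the same values after positions `n₁` and `n₂` for exactly `t` steps, and
different values at `n₁` and `n₂`. -/
structure IsMaximalAgreement (Q : ℕ → ℕ) (n₁ n₂ t : ℕ) : Prop where
  left : Q n₁ ≠ Q n₂
  mid : ∀ j, 1 ≤ j → j ≤ t → Q (n₁ + j) = Q (n₂ + j)
  right : Q (n₁ + (t + 1)) ≠ Q (n₂ + (t + 1))

theorem IsMaximalAgreement.symm {Q : ℕ → ℕ} {n₁ n₂ t : ℕ} (h : IsMaximalAgreement Q n₁ n₂ t) :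
    IsMaximalAgreement Q n₂ n₁ t :=
  ⟨h.left.symm, fun j h1 h2 => (h.mid j h1 h2).symm, h.right.symm⟩

theorem agreementCode_comm (Q : ℕ → ℕ) (n₁ n₂ t : ℕ) :
    agreementCode Q n₁ n₂ t = agreementCode Q n₂ n₁ t := by
  simp only [agreementCode, min_comm]

theorem IsMaximalAgreement.code_eq {Q : ℕ → ℕ} {n₁ n₂ t : ℕ} (h : IsMaximalAgreement Q n₁ n₂ t) :
    agreementCode Q n₁ n₂ t = min (Q n₁) (Q n₂) :: ((List.range' (n₁ + 1) t).map Q ++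
      [min (Q (n₁ + (t + 1))) (Q (n₂ + (t + 1)))]) := by
  rw [agreementCode, List.range_succ_eq_map, List.range_succ, List.range'_eq_map_range]
  simp only [List.map_cons, List.map_append, List.map_map, List.map_nil, add_zero]
  congr 2
  refine List.map_congr_left fun j hj => ?_
  rw [List.mem_range] at hj
  have := h.mid (j + 1) (by omega) (by omega)
  simp only [Function.comp, Nat.succ_eq_add_one, this, min_self]
  rw [← this]; congr 1; ring

section
variable {A : Type*}

/-- The longest common prefix of the rotations that correspond to the code `c`. -/
def codeWord (a b : A) (c : List ℕ) : List A := (c.flatMap (block a b)).dropLast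

theorem IsMaximalAgreement.codeWord_eq {Q : ℕ → ℕ} {n₁ n₂ t : ℕ}
    (h : IsMaximalAgreement Q n₁ n₂ t) (a b : A) :
    codeWord a b (agreementCode Q n₁ n₂ t) = block a b (min (Q n₁) (Q n₂)) ++
      (((List.range' (n₁ + 1) t).map Q).flatMap (block a b) ++
        List.replicate (min (Q (n₁ + (t + 1))) (Q (n₂ + (t + 1)))) b) := by
  rw [codeWord, h.code_eq]
  simp only [List.flatMap_cons, List.flatMap_append, List.flatMap_nil, List.append_nil]
  conv_lhs => enter [1, 2, 2]; rw [block]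
  rw [← List.append_assoc, ← List.append_assoc, List.dropLast_concat]
  simp

theorem IsMaximalAgreement.prefix_left {Q : ℕ → ℕ} {N n₁ n₂ t : ℕ} (ht : t < N)
    (h : IsMaximalAgreement Q n₁ n₂ t) (a b : A) :
    codeWord a b (agreementCode Q n₁ n₂ t) ++
      [if Q (n₁ + (t + 1)) < Q (n₂ + (t + 1)) then a else b] <+:
        blockRotation a b Q N n₁ (min (Q n₁) (Q n₂)) := by
  rw [h.codeWord_eq, blockRotation, List.append_assoc, List.prefix_append_right_inj]
  have e : List.range' (n₁ + 1) N =
      List.range' (n₁ + 1) t ++ (n₁ + (t + 1)) :: List.range' (n₁ + (t + 1) + 1) (N - t - 1) := by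
    rw [← List.range'_succ, show n₁ + (t + 1) = n₁ + 1 + t by ring, List.range'_append_1]
    congr 1; omega
  rw [e, List.map_append, List.flatMap_append, List.append_assoc, List.append_assoc,
    List.prefix_append_right_inj, List.map_cons, List.flatMap_cons, List.append_assoc]
  refine List.IsPrefix.trans ?_ (List.prefix_append _ _)
  split_ifs with hlt
  · rw [min_eq_left hlt.le, block]
  · have hgt := lt_of_le_of_ne (not_lt.1 hlt) h.right.symm
    rw [min_eq_right hgt.le, ← List.replicate_succ', block]
    refine List.IsPrefix.trans ?_ (List.prefix_append _ _)
    refine ⟨List.replicate (Q (n₁ + (t + 1)) - (Q (n₂ + (t + 1)) + 1)) b, ?_⟩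
    rw [List.replicate_append_replicate]
    congr 1; omega

theorem IsMaximalAgreement.prefix_or {Q : ℕ → ℕ} {N n₁ n₂ t : ℕ} (ht : t < N)
    (h : IsMaximalAgreement Q n₁ n₂ t) (a b : A) :
    let v := codeWord a b (agreementCode Q n₁ n₂ t)
    let y := blockRotation a b Q N n₁ (min (Q n₁) (Q n₂))
    let z := blockRotation a b Q N n₂ (min (Q n₁) (Q n₂))
    (v ++ [a] <+: y ∧ v ++ [b] <+: z) ∨ (v ++ [b] <+: y ∧ v ++ [a] <+: z) := by
  have h1 := h.prefix_left ht a b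
  have h2 := h.symm.prefix_left ht a b
  rw [agreementCode_comm, min_comm] at h2
  rcases h.right.lt_or_gt with hlt | hlt
  · rw [if_pos hlt] at h1
    rw [if_neg hlt.not_gt] at h2
    exact Or.inl ⟨h1, h2⟩
  · rw [if_neg hlt.not_gt] at h1
    rw [if_pos hlt] at h2
    exact Or.inr ⟨h1, h2⟩

theorem exists_isMaximalAgreement {a b : A} {Q : ℕ → ℕ} {N : ℕ}
    (hQ : ∀ n, Q (n + (N + 1)) = Q n) {n₁ n₂ p : ℕ} (h1 : p ≤ Q n₁) (h2 : p ≤ Q n₂)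
    (hne : Q n₁ ≠ Q n₂)
    (hlen : (blockRotation a b Q N n₁ p).length = (blockRotation a b Q N n₂ p).length) :
    ∃ t < N, IsMaximalAgreement Q n₁ n₂ t := by
  classical
  have hex : ∃ t, Q (n₁ + (t + 1)) ≠ Q (n₂ + (t + 1)) := ⟨N, by rwa [hQ, hQ]⟩
  have hmid : ∀ j, 1 ≤ j → j ≤ Nat.find hex → Q (n₁ + j) = Q (n₂ + j) := by
    intro j hj1 hj2
    have := Nat.find_min hex (m := j - 1) (by omega)
    rw [not_not, Nat.sub_add_cancel hj1] at this
    exact this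
  refine ⟨Nat.find hex, ?_, hne, hmid, Nat.find_spec hex⟩
  have hle : Nat.find hex ≤ N := Nat.find_min' hex (by rwa [hQ, hQ])
  -- If all `N` other blocks agreed, the equal total lengths would force `Q n₁ = Q n₂`.
  refine lt_of_le_of_ne hle fun he => hne ?_
  have e : (List.range' (n₁ + 1) N).map Q = (List.range' (n₂ + 1) N).map Q := by
    rw [List.range'_eq_map_range, List.range'_eq_map_range, List.map_map, List.map_map]
    refine List.map_congr_left fun j hj => ?_
    rw [List.mem_range] at hj
    have := hmid (j + 1) (by omega) (by omega)
    simpa [add_assoc, add_comm 1 j] using this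
  rw [blockRotation, blockRotation, e] at hlen
  simp at hlen
  omega

end

theorem eq_of_append_singleton_prefix {A : Type*} {v z : List A} {c d : A} (hc : v ++ [c] <+: z)
    (hd : v ++ [d] <+: z) : c = d := by
  have := List.prefix_of_prefix_length_le hc hd (by simp)
  simpa using this.eq_of_length (by simp)

/-- At a change exactly one of two neighbouring rotations has a complete leading run. When the
leading powers of `b` differ, that power is an exponent in `I`, charged at most once as the end of
an interval (`C₁`) and once as a beginning (`C₂`). When they agree (`C₃`), the neighbours part after
a common prefix `v` into `va` and `vb`, which over two letters happens once for each `v`. -/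
theorem rBwt_le_of_blockRotation {A : Type*} [LinearOrder A] {a b : A} (hab : a ≠ b) {Q : ℕ → ℕ}
    {N : ℕ} (hQ : ∀ n, Q (n + (N + 1)) = Q n) {w : List A}
    (hw : w ~r blockRotation a b Q N 0 (Q 0)) (I : Finset ℕ) (hI : ∀ n, Q n ∈ I)
    (K : Finset (List ℕ))
    (hK : ∀ n₁ n₂ t, IsMaximalAgreement Q n₁ n₂ t → agreementCode Q n₁ n₂ t ∈ K) :
    rBwt w ≤ 2 * I.card + K.card + 1 := by
  classical
  have hw0 : w ≠ [] := by
    rintro rfl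
    have := hw.perm.length_eq
    simp [blockRotation, block] at this
  rw [rBwt_eq_card_add_one hw0]
  have hs : ∀ t < w.length, ∃ n p, p ≤ Q n ∧ sortedRotation w t = blockRotation a b Q N n p := by
    intro t ht
    obtain ⟨j, hj⟩ := hw.symm.trans (sortedRotation_isRotated ht)
    obtain ⟨n, p, hp, h⟩ := exists_rotate_eq_blockRotation a b hQ j
    exact ⟨n, p, hp, hj ▸ h⟩
  choose! f p hp hs using hs
  have hb : ∀ t < w.length, block a b (p t) <+: sortedRotation w t := fun t ht => by
    rw [hs t ht]; exact List.prefix_append _ _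
  have hmem : ∀ t ∈ bwtChanges w, t + 1 < w.length ∧
      ¬ (p t = Q (f t) ↔ p (t + 1) = Q (f (t + 1))) := by
    intro t ht
    simp only [bwtChanges, Finset.mem_filter, Finset.mem_range] at ht
    have h1 : t + 1 < w.length := by omega
    refine ⟨h1, fun h => ht.2 ?_⟩
    rw [hs t (by omega), hs (t + 1) h1, getLast?_blockRotation _ _ _ _ _ _ (hp t (by omega)),
      getLast?_blockRotation _ _ _ _ _ _ (hp _ h1)]
    simp only [h]
  set C₁ := (bwtChanges w).filter (fun t => p t ≠ p (t + 1) ∧ p t = Q (f t)) with hC₁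
  set C₂ := (bwtChanges w).filter (fun t => p t ≠ p (t + 1) ∧ p (t + 1) = Q (f (t + 1))) with hC₂
  set C₃ := (bwtChanges w).filter (fun t => p t = p (t + 1)) with hC₃
  have hsub : bwtChanges w ⊆ C₁ ∪ C₂ ∪ C₃ := by
    intro t ht
    have := (hmem t ht).2
    simp only [hC₁, hC₂, hC₃, Finset.mem_union, Finset.mem_filter, ht, true_and]
    tauto
  have hinterval : ∀ r s t, r ≤ s → s ≤ t → t < w.length → p r = p t → p s = p r := by
    intro r s t hrs hst ht hrt
    have h1 := prefix_sortedRotation hrs hst ht (hb r (by omega)) (hrt ▸ hb t ht)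
    exact block_prefix_unique hab (hb s (by omega)) h1
  have hcard₁ : C₁.card ≤ I.card := by
    refine Finset.card_le_card_of_injOn p ?_ ?_
    · intro t ht
      have := (Finset.mem_filter.1 ht).2.2
      rw [this]; exact hI _
    · have key : ∀ s ∈ C₁, ∀ t ∈ C₁, s < t → p s ≠ p t := by
        intro s hs t ht hst h
        have h1 := Finset.mem_filter.1 hs
        have h2 := Finset.mem_filter.1 ht
        have := (hmem t h2.1).1
        exact h1.2.1 (hinterval s (s + 1) t (by omega) (by omega) (by omega) h).symm
      intro s hs t ht h
      rcases lt_trichotomy s t with hst | hst | hst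
      · exact absurd h (key s hs t ht hst)
      · exact hst
      · exact absurd h.symm (key t ht s hs hst)
  have hcard₂ : C₂.card ≤ I.card := by
    refine Finset.card_le_card_of_injOn (fun t => p (t + 1)) ?_ ?_
    · intro t ht
      have := (Finset.mem_filter.1 ht).2.2
      simp only [this]; exact hI _
    · have key : ∀ s ∈ C₂, ∀ t ∈ C₂, s < t → p (s + 1) ≠ p (t + 1) := by
        intro s hs t ht hst h
        have h1 := Finset.mem_filter.1 hs
        have h2 := Finset.mem_filter.1 ht
        have := (hmem t h2.1).1
        exact h2.2.1 ((hinterval (s + 1) t (t + 1) (by omega) (by omega) (by omega) h).trans h)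
      intro s hs t ht h
      rcases lt_trichotomy s t with hst | hst | hst
      · exact absurd h (key s hs t ht hst)
      · exact hst
      · exact absurd h.symm (key t ht s hs hst)
  have hcard₃ : C₃.card ≤ K.card := by
    have hcode : ∀ t ∈ C₃, ∃ c ∈ K,
        (codeWord a b c ++ [a] <+: sortedRotation w t ∧
          codeWord a b c ++ [b] <+: sortedRotation w (t + 1)) ∨
        (codeWord a b c ++ [b] <+: sortedRotation w t ∧
          codeWord a b c ++ [a] <+: sortedRotation w (t + 1)) := by
      intro t ht
      obtain ⟨ht1, ht2⟩ := Finset.mem_filter.1 ht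
      obtain ⟨hlt, hch⟩ := hmem t ht1
      have hp1 := hp t (by omega)
      have hp2 := hp (t + 1) hlt
      have e1 := hs t (by omega)
      have e2 := hs (t + 1) hlt
      rw [← ht2] at hp2 e2 hch
      have hne : Q (f t) ≠ Q (f (t + 1)) := fun h => hch (by rw [h])
      have hmin : min (Q (f t)) (Q (f (t + 1))) = p t := by omega
      obtain ⟨r, hr, hagree⟩ := exists_isMaximalAgreement (a := a) (b := b) hQ hp1 hp2 hne (by
        rw [← e1, ← e2, ← (sortedRotation_isRotated hlt).perm.length_eq,
          ← (sortedRotation_isRotated (w := w) (t := t) (by omega)).perm.length_eq])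
      have := hagree.prefix_or hr a b
      simp only [hmin] at this
      rw [← e1, ← e2] at this
      exact ⟨_, hK _ _ _ hagree, this⟩
    choose! g hgK hg using hcode
    refine Finset.card_le_card_of_injOn g hgK ?_
    have key : ∀ s ∈ C₃, ∀ t ∈ C₃, s < t → g s ≠ g t := by
      intro s hs t ht hst h
      have hlt := (hmem t (Finset.mem_filter.1 ht).1).1
      -- Once the sorted list has passed from `vc` to `vd`, no later rotation starts with `vc`; a
      -- second change with the same code would need one.
      have hx : ∀ c d, c ≠ d → codeWord a b (g s) ++ [c] <+: sortedRotation w s →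
          codeWord a b (g s) ++ [d] <+: sortedRotation w (s + 1) →
          ∀ r, s + 1 ≤ r → r < w.length → ¬ codeWord a b (g s) ++ [c] <+: sortedRotation w r := by
        intro c d hcd hc hd r hsr hr hcr
        exact hcd (eq_of_append_singleton_prefix
          (prefix_sortedRotation (Nat.le_succ s) hsr hr hc hcr) hd)
      have ht' := hg t ht
      rw [← h] at ht'
      rcases hg s hs with ⟨h1, h2⟩ | ⟨h1, h2⟩
      · have := hx a b hab h1 h2
        rcases ht' with ⟨h3, h4⟩ | ⟨h3, h4⟩
        · exact this t hst (by omega) h3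
        · exact this (t + 1) (by omega) hlt h4
      · have := hx b a hab.symm h1 h2
        rcases ht' with ⟨h3, h4⟩ | ⟨h3, h4⟩
        · exact this (t + 1) (by omega) hlt h4
        · exact this t hst (by omega) h3
    intro s hs t ht h
    rcases lt_trichotomy s t with hst | hst | hst
    · exact absurd h (key s hs t ht hst)
    · exact hst
    · exact absurd h.symm (key t ht s hs hst)
  have h1 := Finset.card_le_card hsub
  have h2 := Finset.card_union_le (C₁ ∪ C₂) C₃
  have h3 := Finset.card_union_le C₁ C₂
  omega

/-! ### The block exponents of the iterates -/

/-- The exponents of the blocks `b^q` in `μ^i(a)`, where `μ(a) = a b^(p₁) ⋯ a b^(pₛ) a b^k` with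
`ps = [p₁, …, pₛ]` and `μ(b) = b^ℓ`; the sequence is continued with period `(s + 1)^i`. -/
def blockSeq (ps : List ℕ) (k ℓ : ℕ) : ℕ → ℕ → ℕ
  | 0, _ => 0
  | i + 1, n =>
    if n % (ps.length + 1) = ps.length then k + ℓ * blockSeq ps k ℓ i (n / (ps.length + 1))
    else ps.getD (n % (ps.length + 1)) 0

section
variable (ps : List ℕ) (k ℓ : ℕ)

theorem blockSeq_of_mod_ne {n : ℕ} (i : ℕ) (h : n % (ps.length + 1) ≠ ps.length) :
    blockSeq ps k ℓ (i + 1) n = ps.getD (n % (ps.length + 1)) 0 := by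
  rw [blockSeq, if_neg h]

theorem blockSeq_mul_add_length (i n : ℕ) :
    blockSeq ps k ℓ (i + 1) (n * (ps.length + 1) + ps.length) = k + ℓ * blockSeq ps k ℓ i n := by
  have h1 : (n * (ps.length + 1) + ps.length) % (ps.length + 1) = ps.length := by
    rw [Nat.mul_add_mod_self_right, Nat.mod_eq_of_lt (Nat.lt_succ_self _)]
  have h2 : (n * (ps.length + 1) + ps.length) / (ps.length + 1) = n := by
    rw [mul_comm, Nat.mul_add_div (Nat.succ_pos _), Nat.div_eq_of_lt (Nat.lt_succ_self _), add_zero]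
  rw [blockSeq, if_pos h1, h2]

theorem blockSeq_mul_add_of_lt (i n : ℕ) {d : ℕ} (hd : d < ps.length) :
    blockSeq ps k ℓ (i + 1) (n * (ps.length + 1) + d) = ps.getD d 0 := by
  have h1 : (n * (ps.length + 1) + d) % (ps.length + 1) = d := by
    rw [Nat.mul_add_mod_self_right, Nat.mod_eq_of_lt (by omega)]
  rw [blockSeq_of_mod_ne _ _ _ _ (by omega), h1]

theorem blockSeq_periodic (i n : ℕ) :
    blockSeq ps k ℓ i (n + (ps.length + 1) ^ i) = blockSeq ps k ℓ i n := by
  induction i generalizing n with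
  | zero => rfl
  | succ i ih =>
    rw [blockSeq, blockSeq, pow_succ, Nat.add_mul_mod_self_right,
      Nat.add_mul_div_right _ _ (Nat.succ_pos _), ih]

/-- Counting from the last block of an image makes index `0` a lifted exponent, the only kind at
which congruent positions can disagree. This is the indexing of `liftCode`. -/
theorem blockSeq_shift (i n j : ℕ) :
    blockSeq ps k ℓ (i + 1) (n * (ps.length + 1) + ps.length + j) =
      if j % (ps.length + 1) = 0 then k + ℓ * blockSeq ps k ℓ i (n + j / (ps.length + 1))
      else ps.getD (j % (ps.length + 1) - 1) 0 := by
  have hj := Nat.div_add_mod j (ps.length + 1)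
  have hlt := Nat.mod_lt j (Nat.succ_pos ps.length)
  simp only [Nat.succ_eq_add_one] at hlt
  generalize j / (ps.length + 1) = x at *
  generalize j % (ps.length + 1) = r at *
  subst hj
  split_ifs with h
  · subst h
    rw [← blockSeq_mul_add_length]; congr 1; ring
  · rw [← blockSeq_mul_add_of_lt ps k ℓ i (n + x + 1) (d := r - 1) (by omega)]
    congr 1
    obtain ⟨r, rfl⟩ := Nat.exists_eq_succ_of_ne_zero h
    simp only [Nat.succ_eq_add_one, Nat.add_sub_cancel]
    ring

theorem map_blockSeq_succ (i : ℕ) :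
    (List.range ((ps.length + 1) ^ (i + 1))).map (blockSeq ps k ℓ (i + 1)) =
      ((List.range ((ps.length + 1) ^ i)).map (blockSeq ps k ℓ i)).flatMap
        (fun q => ps ++ [k + ℓ * q]) := by
  have key : ∀ N, (List.range (N * (ps.length + 1))).map (blockSeq ps k ℓ (i + 1)) =
      ((List.range N).map (blockSeq ps k ℓ i)).flatMap (fun q => ps ++ [k + ℓ * q]) := by
    intro N
    induction N with
    | zero => simp
    | succ N ih =>
      rw [Nat.succ_mul, List.range_add, List.map_append, ih, List.range_succ (n := N),
        List.map_append, List.flatMap_append, List.range_succ (n := ps.length)]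
      congr 1
      simp only [List.map_append, List.map_map, List.map_cons, List.map_nil, List.flatMap_cons,
        List.flatMap_nil, List.append_nil, blockSeq_mul_add_length]
      congr 1
      refine List.ext_getElem (by simp) fun d h1 h2 => ?_
      simp [blockSeq_mul_add_of_lt ps k ℓ i N h2, h2]
  rw [pow_succ, key]

theorem iter_eq_flatMap_blockSeq {A : Type*} {a b : A} {μ : A → List A} {ps : List ℕ} {k ℓ : ℕ}
    (hμa : μ a = (ps ++ [k]).flatMap (fun q => a :: List.replicate q b))
    (hμb : μ b = List.replicate ℓ b) (i : ℕ) :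
    iter μ i [a] = ((List.range ((ps.length + 1) ^ i)).map (blockSeq ps k ℓ i)).flatMap
      (fun q => a :: List.replicate q b) := by
  have hb : ∀ q, extend μ (List.replicate q b) = List.replicate (ℓ * q) b := by
    intro q
    induction q with
    | zero => simp [extend]
    | succ q ih =>
      rw [extend] at ih ⊢
      rw [List.replicate_succ, List.flatMap_cons, ih, hμb, List.replicate_append_replicate]
      congr 1; ring
  induction i with
  | zero => simp [iter, blockSeq]
  | succ i ih =>
    rw [iter_succ, ih, map_blockSeq_succ, extend, List.flatMap_assoc, List.flatMap_assoc]
    congr 1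
    funext q
    have := hb q
    rw [extend] at this
    rw [List.flatMap_cons, this, hμa]
    simp only [List.flatMap_append, List.flatMap_cons, List.flatMap_nil, List.append_nil,
      List.replicate_add, List.append_assoc, List.cons_append]

theorem isRotated_iter {A : Type*} {a b : A} {μ : A → List A} {ps : List ℕ} {k ℓ : ℕ}
    (hμa : μ a = (ps ++ [k]).flatMap (fun q => a :: List.replicate q b))
    (hμb : μ b = List.replicate ℓ b) (i : ℕ) :
    iter μ i [a] ~r blockRotation a b (blockSeq ps k ℓ i) ((ps.length + 1) ^ i - 1) 0
      (blockSeq ps k ℓ i 0) := by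
  have h : ∀ l : List ℕ, l.flatMap (fun q => a :: List.replicate q b) ++ [a] =
      a :: l.flatMap (block a b) := by
    intro l
    induction l with
    | nil => rfl
    | cons q l ih => simp [ih, block]
  have hpos : 0 < (ps.length + 1) ^ i := by positivity
  obtain ⟨N, hN⟩ : ∃ N, (ps.length + 1) ^ i = N + 1 := ⟨_, (Nat.sub_add_cancel hpos).symm⟩
  rw [iter_eq_flatMap_blockSeq hμa hμb, hN, Nat.add_sub_cancel]
  refine ⟨1, ?_⟩
  have h' := h ((List.range (N + 1)).map (blockSeq ps k ℓ i))
  rw [List.range_succ_eq_map, List.map_cons, List.flatMap_cons, List.cons_append] at h' ⊢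
  rw [List.rotate_cons_succ, List.rotate_zero]
  rw [List.cons_append, List.cons_inj_right] at h'
  rw [h', blockRotation, List.flatMap_cons, zero_add, List.range'_eq_map_range]
  simp [Function.comp_def, add_comm]

/-- A finite set that contains the values of `blockSeq ps k ℓ i`. -/
def blockValues : ℕ → Finset ℕ
  | 0 => {0}
  | i + 1 => ps.toFinset ∪ (blockValues i).image (fun q => k + ℓ * q)

theorem blockSeq_mem_blockValues (i n : ℕ) : blockSeq ps k ℓ i n ∈ blockValues ps k ℓ i := by
  induction i generalizing n with
  | zero => simp [blockSeq, blockValues]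
  | succ i ih =>
    rw [blockSeq, blockValues, Finset.mem_union]
    split_ifs with h
    · exact Or.inr (Finset.mem_image_of_mem _ (ih _))
    · have hlt := Nat.mod_lt n (Nat.succ_pos ps.length)
      simp only [Nat.succ_eq_add_one] at hlt
      rw [List.getD_eq_getElem _ _ (by omega)]
      exact Or.inl (by simp)

theorem card_blockValues_le (i : ℕ) : (blockValues ps k ℓ i).card ≤ ps.length * i + 1 := by
  induction i with
  | zero => simp [blockValues]
  | succ i ih =>
    rw [blockValues]
    have h1 := Finset.card_union_le ps.toFinset ((blockValues ps k ℓ i).image (fun q => k + ℓ * q))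
    have h2 := Finset.card_image_le (s := blockValues ps k ℓ i) (f := fun q => k + ℓ * q)
    have h3 := List.toFinset_card_le ps
    have : ps.length * (i + 1) = ps.length * i + ps.length := by ring
    omega

theorem iterate_mem_range_blockSeq {p : ℕ} (hp : p ∈ ps) {i j : ℕ} (hj : j < i) :
    ∃ n, blockSeq ps k ℓ i n = (fun q => k + ℓ * q)^[j] p := by
  induction i generalizing j with
  | zero => omega
  | succ i ih =>
    cases j with
    | zero =>
      obtain ⟨d, hd, rfl⟩ := List.getElem_of_mem hp
      refine ⟨0 * (ps.length + 1) + d, ?_⟩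
      rw [blockSeq_mul_add_of_lt _ _ _ _ _ hd, List.getD_eq_getElem _ _ hd]
      rfl
    | succ j =>
      obtain ⟨n, hn⟩ := ih (j := j) (by omega)
      refine ⟨n * (ps.length + 1) + ps.length, ?_⟩
      rw [blockSeq_mul_add_length, hn, Function.iterate_succ_apply']

/-! ### Lifting codes, recognizability, and the linear count of codes -/

/-- The effect of the morphism on the codes of maximal agreements. -/
def liftCode (c : List ℕ) : List ℕ :=
  (List.range ((ps.length + 1) * (c.length - 1) + 1)).map (fun j =>
    if j % (ps.length + 1) = 0 then k + ℓ * c.getD (j / (ps.length + 1)) 0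
    else ps.getD (j % (ps.length + 1) - 1) 0)

variable {ps k ℓ}

/-- At congruent positions only residue `s = ps.length` can carry different exponents, so both ends
of the agreement lie there and `m = s + 1` divides `t + 1`. Since `q ↦ k + ℓq` is injective the
agreement descends to level `i`, and since it is monotone it commutes with the minima at the ends.
-/
theorem IsMaximalAgreement.exists_liftCode (hℓ : 1 ≤ ℓ) {i n₁ n₂ t : ℕ}
    (h : IsMaximalAgreement (blockSeq ps k ℓ (i + 1)) n₁ n₂ t)
    (hmod : n₁ % (ps.length + 1) = n₂ % (ps.length + 1)) :
    ∃ x₁ x₂ s, IsMaximalAgreement (blockSeq ps k ℓ i) x₁ x₂ s ∧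
      agreementCode (blockSeq ps k ℓ (i + 1)) n₁ n₂ t =
        liftCode ps k ℓ (agreementCode (blockSeq ps k ℓ i) x₁ x₂ s) := by
  have hinj : ∀ x y : ℕ, k + ℓ * x = k + ℓ * y → x = y := fun x y hxy =>
    Nat.eq_of_mul_eq_mul_left hℓ (Nat.add_left_cancel hxy)
  have hlast : n₁ % (ps.length + 1) = ps.length := by
    by_contra hne
    apply h.left
    rw [blockSeq_of_mod_ne _ _ _ _ hne, blockSeq_of_mod_ne _ _ _ _ (hmod ▸ hne), hmod]
  have e₁ := Nat.div_add_mod' n₁ (ps.length + 1)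
  have e₂ := Nat.div_add_mod' n₂ (ps.length + 1)
  rw [← hmod] at e₂
  rw [hlast] at e₁ e₂
  generalize n₁ / (ps.length + 1) = x₁ at e₁
  generalize n₂ / (ps.length + 1) = x₂ at e₂
  subst e₁ e₂
  have hr := h.right
  rw [blockSeq_shift, blockSeq_shift] at hr
  have hdvd : (t + 1) % (ps.length + 1) = 0 := by
    by_contra hne
    rw [if_neg hne, if_neg hne] at hr
    exact hr rfl
  rw [if_pos hdvd, if_pos hdvd] at hr
  obtain ⟨s, hs⟩ := Nat.dvd_of_mod_eq_zero hdvd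
  obtain ⟨s, rfl⟩ : ∃ r, s = r + 1 := Nat.exists_eq_succ_of_ne_zero (by rintro rfl; omega)
  have hdiv : (t + 1) / (ps.length + 1) = s + 1 := by
    rw [hs, Nat.mul_div_cancel_left _ (Nat.succ_pos _)]
  refine ⟨x₁, x₂, s, ⟨?_, ?_, ?_⟩, ?_⟩
  · have hl := h.left
    rw [blockSeq_mul_add_length, blockSeq_mul_add_length] at hl
    exact fun h => hl (by rw [h])
  · intro j h1 h2
    have hm := h.mid ((ps.length + 1) * j) (by nlinarith) (by nlinarith)
    rw [blockSeq_shift, blockSeq_shift, if_pos (by simp), if_pos (by simp),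
      Nat.mul_div_cancel_left _ (Nat.succ_pos _)] at hm
    exact hinj _ _ hm
  · rw [hdiv] at hr
    exact fun h => hr (by rw [h])
  · have hlen : (agreementCode (blockSeq ps k ℓ i) x₁ x₂ s).length = s + 2 := by
      simp [agreementCode]
    rw [liftCode, hlen, agreementCode]
    have e : t + 2 = (ps.length + 1) * (s + 2 - 1) + 1 := by
      rw [show s + 2 - 1 = s + 1 from rfl, ← hs]
    rw [e]
    refine List.map_congr_left fun j hj => ?_
    rw [List.mem_range] at hj
    rw [blockSeq_shift, blockSeq_shift]
    split_ifs with hj0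
    · have hlt : j / (ps.length + 1) < s + 2 := by
        rw [Nat.div_lt_iff_lt_mul (Nat.succ_pos _)]
        have : s + 2 - 1 = s + 1 := rfl
        rw [this] at hj
        nlinarith
      rw [List.getD_eq_getElem _ _ (by rwa [hlen])]
      simp only [agreementCode, List.getElem_map, List.getElem_range]
      rcases le_total (blockSeq ps k ℓ i (x₁ + j / (ps.length + 1)))
        (blockSeq ps k ℓ i (x₂ + j / (ps.length + 1))) with hle | hle
      · rw [min_eq_left hle, min_eq_left (by gcongr)]
      · rw [min_eq_right hle, min_eq_right (by gcongr)]
    · exact min_self _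

/-- Recognizability: two positions at which the block sequence agrees for a long time are congruent
modulo the number of blocks of `μ(a)`. -/
theorem lt_of_agree_of_mod_ne (hℓ : 1 ≤ ℓ) (hps : ps ≠ [])
    (hnd : ∀ c, k + ℓ * c = c → ∃ p ∈ ps, p ≠ c) {e n₁ n₂ t : ℕ}
    (hmod : n₁ % (ps.length + 1) ≠ n₂ % (ps.length + 1))
    (hmid : ∀ j, 1 ≤ j → j ≤ t →
      blockSeq ps k ℓ (e + 3) (n₁ + j) = blockSeq ps k ℓ (e + 3) (n₂ + j)) :
    t < (ps.length + 1) ^ 3 + (ps.length + 1) ^ 2 := by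
  by_contra! ht
  have hinj : ∀ x y : ℕ, k + ℓ * x = k + ℓ * y → x = y := fun x y hxy =>
    Nat.eq_of_mul_eq_mul_left hℓ (Nat.add_left_cancel hxy)
  have hlen : 0 < ps.length := List.length_pos_iff.2 hps
  obtain ⟨m, hm⟩ : ∃ m, m = ps.length + 1 := ⟨_, rfl⟩
  have hm3 : 0 < m ^ 3 := by rw [hm]; positivity
  rw [← hm] at ht hmod
  -- Start at a multiple of `m ^ 3`, so that the sequence near `n₁` can be desubstituted three
  -- times; the further `m ^ 2` blocks leave room to read `m` lifted exponents.
  obtain ⟨z, j₀, hz, hj₀, hj₀'⟩ : ∃ z j₀, n₁ + j₀ = z * m ^ 3 ∧ 1 ≤ j₀ ∧ j₀ ≤ m ^ 3 := by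
    have h1 := Nat.div_add_mod' n₁ (m ^ 3)
    have h2 := Nat.mod_lt n₁ hm3
    generalize m ^ 3 = c at *
    generalize n₁ % c = r at *
    refine ⟨n₁ / c + 1, c - r, ?_, by omega, by omega⟩
    rw [Nat.succ_mul]
    generalize n₁ / c * c = y at *
    omega
  set ρ := (n₂ + j₀ + ps.length) % m with hρ
  have hρne : ρ ≠ ps.length := by
    intro h
    apply hmod
    have h1 : n₂ + j₀ + ps.length ≡ z * m ^ 3 + ps.length [MOD m] := by
      rw [Nat.ModEq, ← hρ, h, Nat.add_mod, show z * m ^ 3 % m = 0 by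
        rw [show z * m ^ 3 = z * m ^ 2 * m by ring]; exact Nat.mul_mod_left _ _]
      simp [hm]
    rw [← hz] at h1
    exact (Nat.ModEq.add_right_cancel' _ (Nat.ModEq.add_right_cancel' _ h1)).symm
  -- Steps of length `m` hit lifted exponents on the side of `n₁`, but one fixed entry of `ps` on
  -- the side of `n₂`; so `m` consecutive exponents one level down have the same image.
  have hval : ∀ d ≤ ps.length,
      k + ℓ * blockSeq ps k ℓ (e + 2) (z * m * m + d) = ps.getD ρ 0 := by
    intro d hd
    have hd2 : m * d + ps.length ≤ m ^ 2 := by rw [hm]; nlinarith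
    have h1 := hmid (j₀ + (m * d + ps.length)) (by omega) (by omega)
    have h2 : n₁ + (j₀ + (m * d + ps.length)) =
        (z * m * m + d) * (ps.length + 1) + ps.length := by
      rw [← add_assoc, hz, ← hm]; ring
    have h3 : (n₂ + (j₀ + (m * d + ps.length))) % (ps.length + 1) = ρ := by
      rw [hρ, ← hm, show n₂ + (j₀ + (m * d + ps.length)) = n₂ + j₀ + ps.length + m * d by ring,
        Nat.add_mul_mod_self_left]
    have h4 := blockSeq_of_mod_ne ps k ℓ (e + 2) (by rw [h3]; exact hρne)
    rw [h2, blockSeq_mul_add_length] at h1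
    rw [h1, h4, h3]
  have hlast := hval ps.length le_rfl
  have hfirst : blockSeq ps k ℓ (e + 1) (z * m) = ps.getD 0 0 := by
    rw [hm]; exact blockSeq_mul_add_of_lt ps k ℓ e z (d := 0) hlen
  rw [hm, blockSeq_mul_add_length, ← hm, hfirst] at hlast
  -- These exponents are `p₁, …, pₛ, k + ℓp₁`. Their equality makes every `pⱼ` the same fixed point
  -- of `q ↦ k + ℓq`, against `hnd`.
  have hall : ∀ d < ps.length, ps.getD d 0 = k + ℓ * ps.getD 0 0 := by
    intro d hd
    have h1 := hval d hd.le
    rw [hm, blockSeq_mul_add_of_lt _ _ _ _ _ hd] at h1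
    exact hinj _ _ (h1.trans hlast.symm)
  have h0 := hall 0 hlen
  obtain ⟨p, hp, hpne⟩ := hnd _ h0.symm
  obtain ⟨d, hd, rfl⟩ := List.getElem_of_mem hp
  have := hall d hd
  rw [← h0, List.getD_eq_getElem _ _ hd] at this
  exact hpne this

theorem IsMaximalAgreement.le_of_mod_ne (hℓ : 1 ≤ ℓ) (hps : ps ≠ [])
    (hnd : ∀ c, k + ℓ * c = c → ∃ p ∈ ps, p ≠ c) {i n₁ n₂ t : ℕ}
    (h : IsMaximalAgreement (blockSeq ps k ℓ i) n₁ n₂ t)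
    (hmod : n₁ % (ps.length + 1) ≠ n₂ % (ps.length + 1)) :
    t ≤ (ps.length + 1) ^ 3 + (ps.length + 1) ^ 2 := by
  rcases lt_or_ge i 3 with hi | hi
  -- For small `i` the period `m ^ i` is at most `m ^ 3`; a longer agreement would contain the
  -- positions one period after `n₁` and `n₂`.
  · by_contra! ht
    have h1 : (ps.length + 1) ^ i ≤ (ps.length + 1) ^ 3 := Nat.pow_le_pow_right (by omega) hi.le
    have h2 := h.mid ((ps.length + 1) ^ i) (Nat.one_le_pow _ _ (by omega)) (by omega)
    rw [blockSeq_periodic, blockSeq_periodic] at h2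
    exact h.left h2
  · obtain ⟨e, rfl⟩ : ∃ e, i = e + 3 := ⟨i - 3, by omega⟩
    exact (lt_of_agree_of_mod_ne hℓ hps hnd hmod h.mid).le

/-- At incongruent positions at most one of the two exponents is a lifted one, so the minimum is
bounded by an entry of `ps`. -/
theorem agreementCode_le_of_mod_ne {M : ℕ} (hM : ∀ p ∈ ps, p ≤ M) {i n₁ n₂ t : ℕ}
    (hmod : n₁ % (ps.length + 1) ≠ n₂ % (ps.length + 1)) :
    ∀ q ∈ agreementCode (blockSeq ps k ℓ i) n₁ n₂ t, q ≤ M := by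
  intro q hq
  simp only [agreementCode, List.mem_map] at hq
  obtain ⟨j, -, rfl⟩ := hq
  cases i with
  | zero => simp [blockSeq]
  | succ i =>
    have hle : ∀ d, ps.getD d 0 ≤ M := by
      intro d
      rcases lt_or_ge d ps.length with hd | hd
      · rw [List.getD_eq_getElem _ _ hd]; exact hM _ (List.getElem_mem _)
      · rw [List.getD_eq_default _ _ hd]; exact Nat.zero_le _
    by_cases h1 : (n₁ + j) % (ps.length + 1) = ps.length
    · by_cases h2 : (n₂ + j) % (ps.length + 1) = ps.length
      · exact absurd (Nat.ModEq.add_right_cancel' j (h1.trans h2.symm)) hmod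
      · rw [blockSeq_of_mod_ne _ _ _ _ h2]; exact (min_le_right _ _).trans (hle _)
    · rw [blockSeq_of_mod_ne _ _ _ _ h1]; exact (min_le_left _ _).trans (hle _)

theorem finite_bounded_lists (M L : ℕ) :
    {c : List ℕ | c.length ≤ L ∧ ∀ q ∈ c, q ≤ M}.Finite := by
  refine ((List.finite_length_le (Fin (M + 1)) L).image (List.map Fin.val)).subset ?_
  rintro c ⟨hc, hq⟩
  refine ⟨c.map (Fin.ofNat (M + 1)), by simpa using hc, ?_⟩
  rw [List.map_map]
  conv_rhs => rw [← List.map_id c]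
  refine List.map_congr_left fun q h => ?_
  simp [Nat.mod_eq_of_lt (Nat.lt_succ_of_le (hq q h))]

theorem exists_agreementCodes (hℓ : 1 ≤ ℓ) (hps : ps ≠ [])
    (hnd : ∀ c, k + ℓ * c = c → ∃ p ∈ ps, p ≠ c) :
    ∃ C : ℕ, ∀ i, ∃ K : Finset (List ℕ), K.card ≤ C * i ∧
      ∀ n₁ n₂ t, IsMaximalAgreement (blockSeq ps k ℓ i) n₁ n₂ t →
        agreementCode (blockSeq ps k ℓ i) n₁ n₂ t ∈ K := by
  classical
  set U := (finite_bounded_lists ps.sum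
    ((ps.length + 1) ^ 3 + (ps.length + 1) ^ 2 + 2)).toFinset with hU
  refine ⟨U.card, fun i => ?_⟩
  induction i with
  | zero => exact ⟨∅, by simp, fun n₁ n₂ t h => absurd rfl h.left⟩
  | succ i ih =>
    obtain ⟨K, hK, hmem⟩ := ih
    refine ⟨K.image (liftCode ps k ℓ) ∪ U, ?_, fun n₁ n₂ t h => ?_⟩
    · have h1 := Finset.card_union_le (K.image (liftCode ps k ℓ)) U
      have h2 := Finset.card_image_le (s := K) (f := liftCode ps k ℓ)
      rw [Nat.mul_succ]
      omega
    · rw [Finset.mem_union]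
      by_cases hmod : n₁ % (ps.length + 1) = n₂ % (ps.length + 1)
      · obtain ⟨x₁, x₂, s, hs, he⟩ := h.exists_liftCode hℓ hmod
        rw [he]
        exact Or.inl (Finset.mem_image_of_mem _ (hmem _ _ _ hs))
      · refine Or.inr ?_
        rw [hU, Set.Finite.mem_toFinset]
        refine ⟨?_, agreementCode_le_of_mod_ne (fun p hp => List.single_le_sum (by simp) _ hp) hmod⟩
        have := h.le_of_mod_ne hℓ hps hnd hmod
        simpa [agreementCode] using this

end

/-! ### Factor complexity when `μ(b) = b` and `k = 0` -/

section
variable {A : Type*}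

theorem extend_append (μ : A → List A) (y z : List A) :
    extend μ (y ++ z) = extend μ y ++ extend μ z := by simp [extend]

theorem iter_append (μ : A → List A) (i : ℕ) (y z : List A) :
    iter μ i (y ++ z) = iter μ i y ++ iter μ i z := by
  induction i with
  | zero => rfl
  | succ i ih => rw [iter_succ, iter_succ, iter_succ, ih, extend_append]

theorem iter_nil (μ : A → List A) (i : ℕ) : iter μ i [] = [] := by
  induction i with
  | zero => rfl
  | succ i ih => rw [iter_succ, ih]; rfl

theorem iter_add (μ : A → List A) (i j : ℕ) (w : List A) :
    iter μ (i + j) w = iter μ i (iter μ j w) := Function.iterate_add_apply _ _ _ _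

theorem iter_replicate_of_fixed {μ : A → List A} {b : A} (hμb : μ b = [b]) (i q : ℕ) :
    iter μ i (List.replicate q b) = List.replicate q b := by
  have h : extend μ (List.replicate q b) = List.replicate q b := by
    induction q with
    | zero => rfl
    | succ q ih =>
      rw [extend] at ih ⊢
      rw [List.replicate_succ, List.flatMap_cons, ih, hμb]; rfl
  induction i with
  | zero => rfl
  | succ i ih => rw [iter_succ, ih, h]

theorem iter_flatMap_of_fixed {μ : A → List A} {a b : A} (hμb : μ b = [b]) (i : ℕ) (l : List ℕ) :
    iter μ i (l.flatMap (fun q => a :: List.replicate q b)) =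
      l.flatMap (fun q => iter μ i [a] ++ List.replicate q b) := by
  induction l with
  | nil => exact iter_nil μ i
  | cons q l ih =>
    rw [List.flatMap_cons, List.flatMap_cons, iter_append, ih, ← List.singleton_append, iter_append,
      iter_replicate_of_fixed hμb]

theorem exists_take_drop_flatMap_eq (b : A) (w : List A) {n M : ℕ} (hn : 1 ≤ n) (hw : n ≤ w.length)
    (qs : List ℕ) (hM : ∀ q ∈ qs, q ≤ M) (p : ℕ)
    (hp : p + n ≤ (qs.flatMap (fun q => w ++ List.replicate q b)).length) :
    ∃ q ≤ M, ∃ r < w.length + M,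
      ((qs.flatMap (fun q => w ++ List.replicate q b)).drop p).take n =
        ((w ++ List.replicate q b ++ w).drop r).take n := by
  induction qs generalizing p with
  | nil => simp at hp; omega
  | cons q qs ih =>
    have hq : q ≤ M := hM q (by simp)
    have hM' : ∀ q ∈ qs, q ≤ M := fun q hq => hM q (by simp [hq])
    rw [List.flatMap_cons] at hp ⊢
    have hlen : (w ++ List.replicate q b).length = w.length + q := by simp
    rcases lt_or_ge p (w.length + q) with hlt | hge
    · refine ⟨q, hq, p, by omega, ?_⟩
      generalize w ++ List.replicate q b = y at hlen hp
      cases qs with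
      | nil =>
        rw [List.flatMap_nil, List.append_nil] at hp ⊢
        rw [List.drop_append_of_le_length (by omega),
          List.take_append_of_le_length (by rw [List.length_drop]; omega)]
      | cons q' qs =>
        rw [List.flatMap_cons, List.append_assoc w, ← List.append_assoc y,
          List.drop_append_of_le_length (by rw [List.length_append]; omega),
          List.take_append_of_le_length (by rw [List.length_drop, List.length_append]; omega)]
    · rw [List.length_append, hlen] at hp
      obtain ⟨q', hq', r, hr, h⟩ := ih hM' (p - (w.length + q)) (by omega)
      refine ⟨q', hq', r, hr, ?_⟩
      rw [← h, List.drop_append, List.drop_eq_nil_of_le (by omega), hlen, List.nil_append]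

theorem exists_factor_eq_take_drop {μ : A → List A} {a : A} (hne : ∀ c, μ c ≠ [])
    (h : IsProlongable μ a) {p n i : ℕ} (hi : p + n ≤ (iter μ i [a]).length) :
    (List.range n).map (fun j => fixedPoint μ a (p + j)) = ((iter μ i [a]).drop p).take n := by
  refine List.ext_getElem (by simp; omega) fun j h1 h2 => ?_
  simp only [List.length_map, List.length_range] at h1
  simp only [List.getElem_map, List.getElem_range, List.getElem_take, List.getElem_drop]
  exact (getElem_iter_eq_fixedPoint hne h i (p + j) (by omega)).symm

theorem blockSeq_zero_one_le (ps : List ℕ) (i n : ℕ) : blockSeq ps 0 1 i n ≤ ps.sum := by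
  induction i generalizing n with
  | zero => simp [blockSeq]
  | succ i ih =>
    rw [blockSeq]
    split_ifs
    · simpa using ih _
    · rcases lt_or_ge (n % (ps.length + 1)) ps.length with hd | hd
      · rw [List.getD_eq_getElem _ _ hd]
        exact List.single_le_sum (by simp) _ (List.getElem_mem _)
      · rw [List.getD_eq_default _ _ hd]; exact Nat.zero_le _

theorem length_flatMap_blocks (a b : A) (l : List ℕ) :
    (l.flatMap (fun q => a :: List.replicate q b)).length = l.sum + l.length := by
  induction l with
  | nil => rfl
  | cons q l ih => simp [ih]; ring

/-- Here exponents never grow, so every prefix `μ^(j+r)(a)` is a product of words `w b^q` with `w =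
μ^j(a)` and `q ≤ M = ps.sum`. As `n = m ^ j ≤ |w|`, a window of length `n` lies in some `w b^q w`
and is determined by `q` and an offset below `|w| + M`, where `|w| ≤ (M + 1)n`. -/
theorem factorComplexity_pow_le {μ : A → List A} {a b : A} {ps : List ℕ}
    (hne : ∀ c, μ c ≠ []) (hpr : IsProlongable μ a)
    (hμa : μ a = (ps ++ [0]).flatMap (fun q => a :: List.replicate q b))
    (hμb : μ b = [b]) (j : ℕ) :
    factorComplexity (fixedPoint μ a) ((ps.length + 1) ^ j) ≤
      (ps.sum + 1) * (2 * ps.sum + 1) * (ps.length + 1) ^ j := by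
  classical
  set M := ps.sum with hM
  set n := (ps.length + 1) ^ j with hn
  set w := iter μ j [a] with hw
  have hn1 : 1 ≤ n := Nat.one_le_pow _ _ (by omega)
  have hword := iter_eq_flatMap_blockSeq (k := 0) (ℓ := 1) hμa hμb
  have hlen : w.length = ((List.range n).map (blockSeq ps 0 1 j)).sum + n := by
    rw [hw, hword j, length_flatMap_blocks]; simp [hn]
  have hsum : ((List.range n).map (blockSeq ps 0 1 j)).sum ≤ n * M := by
    refine (List.sum_le_card_nsmul _ M ?_).trans (by simp)
    intro q hq
    obtain ⟨x, -, rfl⟩ := List.mem_map.1 hq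
    exact blockSeq_zero_one_le ps j x
  have hsub : factors (fixedPoint μ a) n ⊆
      ((Finset.range (M + 1) ×ˢ Finset.range (w.length + M)).image
        (fun x => ((w ++ List.replicate x.1 b ++ w).drop x.2).take n) : Finset (List A)) := by
    rintro v ⟨p, rfl⟩
    have hI : p + n ≤ (iter μ (j + (p + n)) [a]).length :=
      (Nat.le_add_left _ _).trans (length_iter_gt hne hpr _).le
    rw [exists_factor_eq_take_drop hne hpr hI]
    rw [iter_add, hword, iter_flatMap_of_fixed hμb] at hI ⊢
    obtain ⟨q, hq, r, hr, h⟩ := exists_take_drop_flatMap_eq b w (M := M) hn1 (by omega) _ (by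
      intro q hq
      obtain ⟨x, -, rfl⟩ := List.mem_map.1 hq
      exact blockSeq_zero_one_le ps _ x) p hI
    rw [h, Finset.mem_coe, Finset.mem_image]
    exact ⟨(q, r), by simp; omega, rfl⟩
  have hcard := Set.ncard_le_ncard hsub (Finset.finite_toSet _)
  rw [Set.ncard_coe_finset] at hcard
  refine (hcard.trans Finset.card_image_le).trans ?_
  rw [Finset.card_product, Finset.card_range, Finset.card_range, mul_assoc]
  refine Nat.mul_le_mul_left _ ?_
  have : M ≤ M * n := Nat.le_mul_of_pos_right _ hn1
  have e : (2 * M + 1) * n = n * M + M * n + n := by ring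
  omega

theorem not_isTheta_sq_of_pow_le {f : ℕ → ℕ} {m C : ℕ} (hm : 2 ≤ m)
    (hf : ∀ j, f (m ^ j) ≤ C * m ^ j) :
    ¬ (fun n : ℕ => (f n : ℝ)) =Θ[atTop] (fun n : ℕ => (n : ℝ) ^ 2) := by
  intro h
  obtain ⟨c, hc⟩ := h.2.bound
  have hlim : Tendsto (fun j : ℕ => m ^ j) atTop atTop :=
    tendsto_pow_atTop_atTop_of_one_lt (by omega)
  have h1 := hlim.eventually hc
  have hlim' : Tendsto (fun j : ℕ => ((m ^ j : ℕ) : ℝ)) atTop atTop :=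
    tendsto_natCast_atTop_atTop.comp hlim
  obtain ⟨j, hj1, hj2⟩ := (h1.and (hlim'.eventually_gt_atTop (|c| * C))).exists
  have hpos : (0 : ℝ) < ((m ^ j : ℕ) : ℝ) := by
    have : 0 < m ^ j := by positivity
    exact_mod_cast this
  have hfj : (f (m ^ j) : ℝ) ≤ C * ((m ^ j : ℕ) : ℝ) := by exact_mod_cast hf j
  rw [Real.norm_of_nonneg (by positivity), Real.norm_of_nonneg (by positivity)] at hj1
  have h2 : c * (f (m ^ j) : ℝ) ≤ |c| * (C * ((m ^ j : ℕ) : ℝ)) :=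
    (mul_le_mul_of_nonneg_right (le_abs_self c) (by positivity)).trans
      (mul_le_mul_of_nonneg_left hfj (abs_nonneg c))
  nlinarith

/-! ### Block form of `μ(a)`, bounds linear in `i`, and the length of the iterates -/

theorem exists_blocks {a b : A} (hA : ∀ c : A, c = a ∨ c = b) (u : List A) :
    ∃ ps : List ℕ, ps ≠ [] ∧ a :: u = ps.flatMap (fun q => a :: List.replicate q b) := by
  induction u with
  | nil => exact ⟨[0], by simp, by simp⟩
  | cons c u ih =>
    obtain ⟨ps, hps, h⟩ := ih
    obtain ⟨p, ps, rfl⟩ := List.exists_cons_of_ne_nil hps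
    rw [List.flatMap_cons, List.cons_append, List.cons_inj_right] at h
    rcases hA c with rfl | rfl
    · exact ⟨0 :: p :: ps, by simp, by simp [h]⟩
    · exact ⟨(p + 1) :: ps, by simp, by simp [h, List.replicate_succ]⟩

theorem length_iter_le (μ : A → List A) {K : ℕ} (hK : ∀ c, (μ c).length ≤ K) (i : ℕ) (c : A) :
    (iter μ i [c]).length ≤ K ^ i := by
  have h : ∀ w : List A, (extend μ w).length ≤ w.length * K := by
    intro w
    induction w with
    | nil => simp [extend]
    | cons d w ih =>
      have := hK d
      rw [extend] at ih ⊢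
      rw [List.flatMap_cons, List.length_append, List.length_cons, Nat.succ_mul]
      omega
  induction i with
  | zero => simp [iter]
  | succ i ih =>
    rw [iter_succ, pow_succ]
    exact (h _).trans (Nat.mul_le_mul_right _ ih)

theorem isUltimatelyPeriodic_of_replicate {μ : A → List A} {a : A} {m : ℕ}
    (h : μ a = List.replicate m a) : IsUltimatelyPeriodic (fixedPoint μ a) := by
  have hmem : ∀ i, ∀ c ∈ iter μ i [a], c = a := by
    intro i
    induction i with
    | zero => simp [iter]
    | succ i ih =>
      intro c hc
      rw [iter_succ, extend, List.mem_flatMap] at hc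
      obtain ⟨d, hd, hc⟩ := hc
      rw [ih d hd, h] at hc
      exact List.eq_of_mem_replicate hc
  have hconst : ∀ n, fixedPoint μ a n = a := by
    intro n
    rw [fixedPoint]
    rcases lt_or_ge n (iter μ n [a]).length with hn | hn
    · rw [List.getD_eq_getElem _ _ hn]; exact hmem _ _ (List.getElem_mem _)
    · rw [List.getD_eq_default _ _ hn]
  exact ⟨1, one_pos, 0, fun n _ => by rw [hconst, hconst]⟩

end

theorem exists_lt_image_of_nondegenerate {ps : List ℕ} {k ℓ : ℕ} (hℓ : 1 ≤ ℓ) (hps : ps ≠ [])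
    (hkℓ : ¬ (k = 0 ∧ ℓ = 1)) (hnd : ∀ c, k + ℓ * c = c → ∃ p ∈ ps, p ≠ c) :
    ∃ p ∈ ps, p < k + ℓ * p := by
  rcases Nat.eq_zero_or_pos k with rfl | hk
  · obtain ⟨p, hp, hp0⟩ := hnd 0 (by simp)
    refine ⟨p, hp, ?_⟩
    have h2 : 2 ≤ ℓ := by omega
    have : 0 < p := Nat.pos_of_ne_zero hp0
    nlinarith
  · obtain ⟨p, hp⟩ := List.exists_mem_of_ne_nil _ hps
    exact ⟨p, hp, by nlinarith⟩

theorem le_ncard_circularRuns_iter {A : Type*} {a b : A} {μ : A → List A} {ps : List ℕ} {k ℓ : ℕ}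
    (hℓ : 1 ≤ ℓ) (hμa : μ a = (ps ++ [k]).flatMap (fun q => a :: List.replicate q b))
    (hμb : μ b = List.replicate ℓ b) (hp : ∃ p ∈ ps, p < k + ℓ * p) (i : ℕ) :
    i ≤ (circularRuns a b (iter μ i [a])).ncard := by
  obtain ⟨p, hp, hlt⟩ := hp
  have hmono : StrictMono (fun j => (fun q => k + ℓ * q)^[j] p) := by
    refine StrictMono.strictMono_iterate_of_lt_map (f := fun q => k + ℓ * q) ?_ hlt
    intro x y hxy
    have := Nat.mul_lt_mul_of_pos_left hxy hℓ
    simp only; omega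
  have hsub : (fun j => (fun q => k + ℓ * q)^[j] p) '' (Set.Iio i) ⊆
      circularRuns a b (iter μ i [a]) := by
    rintro _ ⟨j, hj, rfl⟩
    obtain ⟨n, hn⟩ := iterate_mem_range_blockSeq ps k ℓ hp hj
    simp only
    rw [← hn]
    refine mem_circularRuns_blockRotation a b (fun n => ?_) (isRotated_iter hμa hμb i) n
    rw [Nat.sub_add_cancel (Nat.one_le_pow _ _ (Nat.succ_pos _)), blockSeq_periodic]
  have h := Set.ncard_le_ncard hsub (circularRuns_finite _ _ _)
  rw [Set.ncard_image_of_injective _ hmono.injective, Set.ncard_Iio_nat] at h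
  exact h

theorem exists_rBwt_iter_le {A : Type*} [LinearOrder A] {a b : A} (hab : a ≠ b) {μ : A → List A}
    {ps : List ℕ} {k ℓ : ℕ} (hℓ : 1 ≤ ℓ) (hps : ps ≠ [])
    (hnd : ∀ c, k + ℓ * c = c → ∃ p ∈ ps, p ≠ c)
    (hμa : μ a = (ps ++ [k]).flatMap (fun q => a :: List.replicate q b))
    (hμb : μ b = List.replicate ℓ b) :
    ∃ C : ℕ, ∀ i, 1 ≤ i → rBwt (iter μ i [a]) ≤ C * i := by
  obtain ⟨C, hC⟩ := exists_agreementCodes hℓ hps hnd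
  refine ⟨2 * ps.length + C + 3, fun i hi => ?_⟩
  obtain ⟨K, hK, hmem⟩ := hC i
  have h := rBwt_le_of_blockRotation hab (fun n => by
    rw [Nat.sub_add_cancel (Nat.one_le_pow _ _ (Nat.succ_pos _)), blockSeq_periodic])
    (isRotated_iter hμa hμb i) _ (blockSeq_mem_blockValues ps k ℓ i) K hmem
  have h2 := card_blockValues_le ps k ℓ i
  have e : (2 * ps.length + C + 3) * i = 2 * (ps.length * i) + C * i + 3 * i := by ring
  omega

theorem isTheta_natCast_log {L : ℕ → ℕ} {m K : ℕ} (hm : 2 ≤ m) (hL : ∀ i, m ^ i ≤ L i)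
    (hK : ∀ i, L i ≤ K ^ i) :
    (fun i : ℕ => (i : ℝ)) =Θ[atTop] (fun i : ℕ => Real.log (L i)) := by
  have hlow : ∀ i : ℕ, (i : ℝ) * Real.log m ≤ Real.log (L i) := by
    intro i
    rw [← Real.log_pow]
    exact Real.log_le_log (by positivity) (by exact_mod_cast hL i)
  have hup : ∀ i : ℕ, Real.log (L i) ≤ (i : ℝ) * Real.log K := by
    intro i
    rw [← Real.log_pow]
    refine Real.log_le_log ?_ (by exact_mod_cast hK i)
    have : 0 < L i := (by positivity : 0 < m ^ i).trans_le (hL i)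
    exact_mod_cast this
  have hlog : 0 < Real.log m := Real.log_pos (by exact_mod_cast hm)
  have hnn : ∀ i : ℕ, 0 ≤ Real.log (L i) := fun i => Real.log_natCast_nonneg _
  refine ⟨IsBigO.of_bound (Real.log m)⁻¹ (Eventually.of_forall fun i => ?_),
    IsBigO.of_bound (Real.log K) (Eventually.of_forall fun i => ?_)⟩
  · rw [Real.norm_of_nonneg (by positivity), Real.norm_of_nonneg (hnn i), inv_mul_eq_div,
      le_div_iff₀ hlog]
    exact hlow i
  · rw [Real.norm_of_nonneg (hnn i), Real.norm_of_nonneg (by positivity), mul_comm]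
    exact hup i

theorem isBigO_natCast_of_le {f g : ℕ → ℕ} {C : ℕ} (h : ∀ i, 1 ≤ i → f i ≤ C * g i) :
    (fun i : ℕ => (f i : ℝ)) =O[atTop] (fun i : ℕ => (g i : ℝ)) := by
  refine IsBigO.of_bound (C : ℝ) (eventually_atTop.2 ⟨1, fun i hi => ?_⟩)
  rw [Real.norm_of_nonneg (by positivity), Real.norm_of_nonneg (by positivity)]
  exact_mod_cast h i hi

end MorphicBWT

theorem mainTheorem2 {A : Type*} [LinearOrder A] (a b : A) (hab : a ≠ b)
    (hA : ∀ c : A, c = a ∨ c = b)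
    (μ : A → List A) (u : List A) (k ℓ : ℕ) (hℓ : 1 ≤ ℓ)
    (hμa : μ a = [a] ++ u ++ [a] ++ List.replicate k b)
    (hμb : μ b = List.replicate ℓ b)
    (hprim : ¬ MorphicBWT.IsPrimitive μ)
    (haper : MorphicBWT.IsAperiodic (MorphicBWT.fixedPoint μ a)) :
    ((fun i : ℕ => ((MorphicBWT.runSet a b (MorphicBWT.iter μ i [a])).ncard : ℝ)) =O[atTop]
        (fun i : ℕ => (MorphicBWT.rBwt (MorphicBWT.iter μ i [a]) : ℝ))) ∧
    ((MorphicBWT.IsGrowing μ ∨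
        (¬ MorphicBWT.IsGrowing μ ∧
          (fun n : ℕ => (MorphicBWT.factorComplexity (MorphicBWT.fixedPoint μ a) n : ℝ)) =Θ[atTop]
            (fun n : ℕ => (n : ℝ) ^ 2))) →
      ((fun i : ℕ => (i : ℝ)) =O[atTop]
        (fun i : ℕ => (MorphicBWT.rBwt (MorphicBWT.iter μ i [a]) : ℝ))) ∧
      ((fun i : ℕ => (MorphicBWT.rBwt (MorphicBWT.iter μ i [a]) : ℝ)) =Θ[atTop]
        (fun i : ℕ => Real.log ((MorphicBWT.iter μ i [a]).length : ℝ)))) := by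
  open MorphicBWT in
  have hpr : IsProlongable μ a := ⟨u ++ [a] ++ List.replicate k b, by simp, by simp [hμa]⟩
  have hne : ∀ c, μ c ≠ [] := by
    intro c
    rcases hA c with rfl | rfl
    · simp [hμa]
    · rw [hμb, Ne, List.replicate_eq_nil_iff]; omega
  obtain ⟨ps, hps, hu⟩ := exists_blocks hA u
  have hlen : 0 < ps.length := List.length_pos_iff.2 hps
  have hμa' : μ a = (ps ++ [k]).flatMap (fun q => a :: List.replicate q b) := by
    rw [List.flatMap_append, ← hu, hμa]; simp
  have hw : ∀ i, iter μ i [a] ≠ [] := by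
    intro i
    obtain ⟨v, hv⟩ := iter_eq_cons hpr i
    simp [hv]
  have hlow : ∀ i, (circularRuns a b (iter μ i [a])).ncard ≤ rBwt (iter μ i [a]) :=
    fun i => ncard_circularRuns_le_rBwt hab (hw i)
  refine ⟨isBigO_natCast_of_le (C := 1) fun i _ => ?_, fun hgr => ?_⟩
  · rw [one_mul]
    exact (Set.ncard_le_ncard (runSet_subset_circularRuns a b _) (circularRuns_finite a b _)).trans
      (hlow i)
  have hkℓ : ¬ (k = 0 ∧ ℓ = 1) := by
    rintro ⟨rfl, rfl⟩
    rcases hgr with hgr | ⟨-, hsq⟩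
    · have h := hgr b
      have e : ∀ i, (iter μ i [b]).length = 1 := fun i => by
        have := iter_replicate_of_fixed hμb i 1
        rw [List.replicate_one] at this
        rw [this]; rfl
      simp only [e] at h
      exact not_tendsto_const_atTop _ _ h
    · exact not_isTheta_sq_of_pow_le (m := ps.length + 1) (by omega)
        (factorComplexity_pow_le hne hpr hμa' hμb) hsq
  have hnd : ∀ c, k + ℓ * c = c → ∃ p ∈ ps, p ≠ c := by
    intro c hc
    by_contra! hall
    have hle : c ≤ ℓ * c := Nat.le_mul_of_pos_left _ hℓ
    -- A fixed point `c` forces `k = 0`, hence `ℓ ≥ 2` by `hkℓ` and `c = 0`; then `μ(a)` is a power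
    -- of `a`, and the infinite word is constant.
    obtain rfl : k = 0 := by omega
    have h2 : 2 ≤ ℓ := by omega
    obtain rfl : c = 0 := by nlinarith
    refine haper (isUltimatelyPeriodic_of_replicate (m := ps.length + 1) ?_)
    rw [hμa', List.eq_replicate_of_mem hall]
    simp [List.flatMap_replicate, List.replicate_succ']
  have hi : ∀ i, i ≤ rBwt (iter μ i [a]) := fun i =>
    (le_ncard_circularRuns_iter hℓ hμa' hμb
      (exists_lt_image_of_nondegenerate hℓ hps hkℓ hnd) i).trans (hlow i)
  have hO : (fun i : ℕ => (i : ℝ)) =O[atTop] (fun i : ℕ => (rBwt (iter μ i [a]) : ℝ)) :=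
    isBigO_natCast_of_le (f := fun i => i) (C := 1) fun i _ => by rw [one_mul]; exact hi i
  obtain ⟨C, hC⟩ := exists_rBwt_iter_le hab hℓ hps hnd hμa' hμb
  refine ⟨hO, IsTheta.trans ⟨isBigO_natCast_of_le (g := fun i => i) hC, hO⟩
    (isTheta_natCast_log (m := ps.length + 1) (K := max (μ a).length (μ b).length) (by omega)
      (fun i => ?_) (fun i => length_iter_le μ (fun c => ?_) i a))⟩
  · rw [iter_eq_flatMap_blockSeq hμa' hμb, length_flatMap_blocks]
    simp
  · rcases hA c with rfl | rfl
    · exact le_max_left _ _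
    · exact le_max_right _ _
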